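/- Let $k, r \ge 0$ be integers and $n = k + r$, where $k \ge 1$ unless $r = 0$. Superspace $\mathbb{Q}[\mathbf{x}_n, \boldsymbol{\theta}_n]$ is the unital associative $\mathbb{Q}$-algebra generated by $x_1, \dots, x_n, \theta_1, \dots, \theta_n$ with relations $x_i x_j = x_j x_i$, $x_i \theta_j = \theta_j x_i$, $\theta_i \theta_j = -\theta_j \theta_i$ (equivalently, $\mathbb{Q}[x_1,\dots,x_n] \otimes \bigwedge(\theta_1,\dots,\theta_n)$). The symmetric group $\mathfrak{S}_n$ acts on it by $w \cdot x_i = x_{w(i)}$, $w \cdot \theta_i = \theta_{w(i)}$; let $\varepsilon_n = \sum_{w \in \mathfrak{S}_n} \mathrm{sign}(w)\, w$, and let $\partial_i$ be partial differentiation with respect to $x_i$, the $\theta$-variables being treated as constants. For $\mathbf{a} = (a_1, \dots, a_r) \in (\mathbb{Z}_{\ge 0})^r$ put $$\Delta_n(\mathbf{a}) = \varepsilon_n \cdot \bigl(x_1^{a_1} \cdots x_r^{a_r}\, x_{r+1}^{k-1} x_{r+2}^{k-2} \cdots x_{n-1}^1 x_n^0 \cdot \theta_1 \theta_2 \cdots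 \theta_r\bigr),$$ and let $V_n(\mathbf{a})$ be the smallest $\mathbb{Q}$-linear subspace of $\mathbb{Q}[\mathbf{x}_n, \boldsymbol{\theta}_n]$ that contains $\Delta_n(\mathbf{a})$ and is closed under $\partial_1, \dots, \partial_n$. Let $\mathbf{a} = (k-1, \dots, k-1)$ with $r = n-k$ entries. Then $V_n(\mathbf{a})$ is graded by $x$-degree, $V_n(\mathbf{a}) = \bigoplus_{d \ge 0} V_n(\mathbf{a})_d$, with finite-dimensional pieces, and its Hilbert series is $$\mathrm{Hilb}(V_n(\mathbf{a}); q) := \sum_{d \ge 0} \dim_{\mathbb{Q}} \bigl(V_n(\mathbf{a})_d\bigr)\, q^d = [k]!_q \cdot \mathrm{Stir}_q(n,k).$$ Here $[m]_q = 1 + q + \cdots + q^{m-1}$, $[k]!_q = [k]_q [k-1]_q \cdots [1]_q$, and the $q$-Stirling numbers are defined by $\mathrm{Stir}_q(0,k) = \delta_{k,0}$ and $\mathrm{Stir}_q(n,k) = \mathrm{Stir}_q(n-1,k-1) + [k]_q \cdot \mathrm{Stir}_q(n-1,k)$ for $n \ge 1$, $k \ge 0$, with $\mathrm{Stir}_q(n-1,-1)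 = 0$. -/

import Mathlib

open scoped TensorProduct

noncomputable section

namespace SuperVandermonde

/-- Superspace of rank `n`: the `ℚ`-algebra `ℚ[x₁, …, xₙ] ⊗ ⋀(θ₁, …, θₙ)` (ordinary tensor product
of algebras), in which the `x`'s are central and the `θ`'s anticommute. Variables are indexed by
`Fin n`, that is from `0` to `n - 1`. -/
abbrev Superspace (n : ℕ) : Type :=
  MvPolynomial (Fin n) ℚ ⊗[ℚ] ExteriorAlgebra ℚ (Fin n → ℚ)

/-- The commuting variable `xᵢ`. -/
def x {n : ℕ} (i : Fin n) : Superspace n :=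
  MvPolynomial.X i ⊗ₜ[ℚ] 1

/-- The anticommuting variable `θᵢ`. -/
def theta {n : ℕ} (i : Fin n) : Superspace n :=
  1 ⊗ₜ[ℚ] ExteriorAlgebra.ι ℚ (Pi.single i 1 : Fin n → ℚ)

/-- The diagonal action of a permutation `w`: the algebra endomorphism with
`xᵢ ↦ x_{w(i)}` and `θᵢ ↦ θ_{w(i)}`. -/
def permAct {n : ℕ} (w : Equiv.Perm (Fin n)) : Superspace n →ₐ[ℚ] Superspace n :=
  Algebra.TensorProduct.map (MvPolynomial.rename w)
    (ExteriorAlgebra.map (LinearMap.funLeft ℚ ℚ w.symm))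

theorem permAct_x {n : ℕ} (w : Equiv.Perm (Fin n)) (i : Fin n) : permAct w (x i) = x (w i) := by
  simp [permAct, x]

theorem permAct_theta {n : ℕ} (w : Equiv.Perm (Fin n)) (i : Fin n) :
    permAct w (theta i) = theta (w i) := by
  have h : LinearMap.funLeft ℚ ℚ w.symm (Pi.single i 1 : Fin n → ℚ) = Pi.single (w i) 1 := by
    ext j
    simp [LinearMap.funLeft_apply, Pi.single_apply, Equiv.symm_apply_eq]
  simp [permAct, theta, h]

/-- The antisymmetrizer `εₙ = ∑_w sign(w) w`. -/
def antisymm {n : ℕ} (f : Superspace n) : Superspace n :=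
  ∑ w : Equiv.Perm (Fin n), ((Equiv.Perm.sign w : ℤ) : ℚ) • permAct w f

/-- The operator `∂ᵢ`: partial differentiation with respect to `xᵢ`, the `θ`'s being constants. -/
def partialX {n : ℕ} (i : Fin n) : Superspace n →ₗ[ℚ] Superspace n :=
  TensorProduct.map (MvPolynomial.pderiv i).toLinearMap LinearMap.id

/-- The `a`-superspace Vandermonde for `a = (a₁, …, a_r)` and `n = r + k`:
`εₙ · (x₁^{a₁} ⋯ x_r^{a_r} · x_{r+1}^{k-1} x_{r+2}^{k-2} ⋯ xₙ^0 · θ₁ ⋯ θ_r)`.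
`Fin.castAdd k i` runs through the first `r` indices, `Fin.natAdd r j` through the last `k`. -/
def vandermonde (k r : ℕ) (a : Fin r → ℕ) : Superspace (r + k) :=
  antisymm
    ((List.ofFn fun i : Fin r => x (Fin.castAdd k i) ^ a i).prod *
      (List.ofFn fun j : Fin k => x (Fin.natAdd r j) ^ (k - 1 - (j : ℕ))).prod *
      (List.ofFn fun i : Fin r => theta (Fin.castAdd k i)).prod)

/-- `Vₙ(a)` with `n = r + k`: the smallest `ℚ`-subspace of superspace that contains the
`a`-superspace Vandermonde and is closed under `∂₁, …, ∂ₙ`. -/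
def V (k r : ℕ) (a : Fin r → ℕ) : Submodule ℚ (Superspace (r + k)) :=
  sInf {W | vandermonde k r a ∈ W ∧ ∀ i, ∀ f ∈ W, partialX i f ∈ W}

/-- The superpolynomials that are `x`-homogeneous of `x`-degree `d` (including `0`). -/
def xHomogeneous (n d : ℕ) : Submodule ℚ (Superspace n) :=
  LinearMap.range
    (TensorProduct.map (MvPolynomial.homogeneousSubmodule (Fin n) ℚ d).subtype
      (LinearMap.id : ExteriorAlgebra ℚ (Fin n → ℚ) →ₗ[ℚ] ExteriorAlgebra ℚ (Fin n → ℚ)))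

/-- The piece of `x`-degree `d` of a subspace `W` of superspace, as a subspace of `W`. -/
def gradedPiece {n : ℕ} (W : Submodule ℚ (Superspace n)) (d : ℕ) : Submodule ℚ W :=
  (xHomogeneous n d).submoduleOf W

/-- The Hilbert series `∑_d dim(W_d) q^d` of a subspace of superspace, graded by `x`-degree. -/
def hilb {n : ℕ} (W : Submodule ℚ (Superspace n)) : PowerSeries ℤ :=
  PowerSeries.mk fun d => (Module.finrank ℚ (gradedPiece W d) : ℤ)

/-- `[m]_q = 1 + q + ⋯ + q^{m-1}`; the polynomial variable is `q`. -/
def qNumber (m : ℕ) : Polynomial ℤ :=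
  ∑ i ∈ Finset.range m, Polynomial.X ^ i

/-- `[m]!_q = [m]_q [m-1]_q ⋯ [1]_q`. -/
def qFactorial (m : ℕ) : Polynomial ℤ :=
  ∏ i ∈ Finset.range m, qNumber (i + 1)

/-- The `q`-Stirling numbers of the second kind: `Stir_q(0, k) = δ_{k,0}` and
`Stir_q(n, k) = Stir_q(n-1, k-1) + [k]_q Stir_q(n-1, k)`, where `Stir_q(n-1, -1) = 0`. -/
def qStirling : ℕ → ℕ → Polynomial ℤ
  | 0, 0 => 1
  | 0, _ + 1 => 0
  | n + 1, 0 => qNumber 0 * qStirling n 0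
  | n + 1, k + 1 => qStirling n k + qNumber (k + 1) * qStirling n (k + 1)

end SuperVandermonde

end

noncomputable section

namespace SuperVandermonde

/-! Write `n = r + k` and `Δ` for the Vandermonde. Polynomials act on superspace by `xᵢ ↦ ∂ᵢ`, and
`V` is the orbit `ℚ[x] · Δ`, that is, `ℚ[x]` modulo the annihilator of `Δ`. The theorem follows once
certain monomials, the standard ones, give a basis `x^m · Δ`.

Spanning: the annihilator contains `xᵢ ^ k`, because all exponents in `Δ` are below `k`, and `e_d`
for `d > r` (`act_elemSym_vandermonde`). Straightening modulo these relations alone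
(`aeval_mul_mem_sup_span`) leaves only the exponents in `stdExp k n k`.

Independence: every standard `m` lies under some shuffle of the staircase `k-1, …, 1, 0` with `r`
letters `k-1`. The shuffle and `m` determine a coefficient functional that is nonzero on `x^m · Δ`
and vanishes on `x^{m'} · Δ` for every lexicographically larger `m'`, so the system is triangular.

Counting: `x^m · Δ` is homogeneous, of degree the codegree of `m`. Reading words letter by letter
gives a recursion for the codegree generating function, which `stdGen_self` solves as `[k]!_q
Stir_q(n, k)`. -/

/-- The elementary symmetric polynomial of degree `d` evaluated at a finite family. -/
def elemSym {A : Type*} [CommRing A] {t : ℕ} (y : Fin t → A) (d : ℕ) : A :=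
  (∏ i, (1 + Polynomial.C (y i) * Polynomial.X)).coeff d

/-! ### Elementary symmetric polynomials -/

section elemSym

variable {A : Type*} [CommRing A]

theorem elemSym_zero {t : ℕ} (y : Fin t → A) : elemSym y 0 = 1 := by
  simp [elemSym, Polynomial.coeff_zero_eq_eval_zero, Polynomial.eval_prod]

theorem elemSym_succ {t : ℕ} (y : Fin (t + 1) → A) (d : ℕ) :
    elemSym y (d + 1) = elemSym (Fin.tail y) (d + 1) + y 0 * elemSym (Fin.tail y) d := by
  unfold elemSym
  rw [Fin.prod_univ_succ, add_mul, one_mul, Polynomial.coeff_add, mul_assoc,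
    Polynomial.coeff_C_mul, Polynomial.coeff_X_mul]
  rfl

theorem elemSym_eq_zero {t d : ℕ} (y : Fin t → A) (h : t < d) : elemSym y d = 0 := by
  induction t generalizing d with
  | zero => simp [elemSym, Polynomial.coeff_one, h.ne']
  | succ t ih =>
    obtain ⟨d, rfl⟩ : ∃ e, d = e + 1 := ⟨d - 1, by omega⟩
    rw [elemSym_succ, ih _ (by omega), ih _ (by omega), mul_zero, add_zero]

theorem map_elemSym {B : Type*} [CommRing B] (φ : A →+* B) {t : ℕ} (y : Fin t → A) (d : ℕ) :
    φ (elemSym y d) = elemSym (fun i => φ (y i)) d := by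
  unfold elemSym
  rw [← Polynomial.coeff_map, Polynomial.map_prod]
  simp

theorem elemSym_eq_sum {t : ℕ} (y : Fin t → A) (d : ℕ) :
    elemSym y d = ∑ s : Finset (Fin t), if s.card = d then ∏ i ∈ s, y i else 0 := by
  unfold elemSym
  rw [Finset.prod_one_add, Finset.powerset_univ, Polynomial.finsetSum_coeff]
  refine Finset.sum_congr rfl fun s _ => ?_
  rw [Finset.prod_mul_distrib, Finset.prod_const, ← map_prod, Polynomial.coeff_C_mul_X_pow]
  simp only [eq_comm]

end elemSym

/-! ### Standard monomials and straightening -/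

/-- Prepending a letter to a word. -/
def consEmbedding (n : ℕ) : (Σ _ : ℕ, (Fin n → ℕ)) ↪ (Fin (n + 1) → ℕ) where
  toFun p := Fin.cons p.1 p.2
  inj' := by
    rintro ⟨c, m⟩ ⟨c', m'⟩ h
    obtain ⟨h1, h2⟩ := Fin.cons_inj.1 h
    subst h1
    subst h2
    rfl

theorem consEmbedding_apply {n : ℕ} (c : ℕ) (m : Fin n → ℕ) :
    consEmbedding n ⟨c, m⟩ = Fin.cons c m := rfl

/-- The exponents of the standard monomials: words of length `n` in `{0, …, k - 1}`, read from the
left with a counter that starts at `s`, drops by one at each letter below its current value, and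
has to end at zero. -/
def stdExp (k : ℕ) : (n : ℕ) → ℕ → Finset (Fin n → ℕ)
  | 0, s => if s = 0 then {Fin.elim0} else ∅
  | n + 1, s =>
    ((Finset.range k).sigma fun c => stdExp k n (if c < s then s - 1 else s)).map
      (consEmbedding n)

theorem mem_stdExp_succ {k n s : ℕ} {m : Fin (n + 1) → ℕ} :
    m ∈ stdExp k (n + 1) s ↔
      m 0 < k ∧ Fin.tail m ∈ stdExp k n (if m 0 < s then s - 1 else s) := by
  simp only [stdExp, Finset.mem_map, Finset.mem_sigma, Finset.mem_range]
  constructor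
  · rintro ⟨⟨c, m'⟩, ⟨hc, hm⟩, rfl⟩
    exact ⟨hc, hm⟩
  · rintro ⟨hc, hm⟩
    exact ⟨⟨m 0, Fin.tail m⟩, ⟨hc, hm⟩, Fin.cons_self_tail m⟩

theorem exists_eq_rename_succ_add {R : Type*} [CommRing R] {t : ℕ}
    (f : MvPolynomial (Fin (t + 1)) R) :
    ∃ g h, f = MvPolynomial.rename Fin.succ g + MvPolynomial.X 0 * h := by
  induction f using MvPolynomial.induction_on with
  | C c => exact ⟨MvPolynomial.C c, 0, by simp⟩
  | add p q hp hq =>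
    obtain ⟨g, h, rfl⟩ := hp
    obtain ⟨g', h', rfl⟩ := hq
    exact ⟨g + g', h + h', by rw [map_add]; ring⟩
  | mul_X p i hp =>
    obtain ⟨g, h, hp⟩ := hp
    refine Fin.cases ⟨0, p, by rw [map_zero]; ring⟩ (fun j => ?_) i
    refine ⟨g * MvPolynomial.X j, h * MvPolynomial.X j.succ, ?_⟩
    rw [hp, map_mul, MvPolynomial.rename_X]
    ring

theorem aeval_mul_mem {A : Type*} [CommRing A] [Algebra ℚ A] {t : ℕ} (y : Fin t → A)
    (N : Submodule ℚ A) (hN : ∀ i, ∀ v ∈ N, y i * v ∈ N) (f : MvPolynomial (Fin t) ℚ) :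
    ∀ v ∈ N, MvPolynomial.aeval y f * v ∈ N := by
  induction f using MvPolynomial.induction_on with
  | C c =>
    intro v hv
    rw [MvPolynomial.aeval_C, ← Algebra.smul_def]
    exact N.smul_mem _ hv
  | add p q hp hq =>
    intro v hv
    rw [map_add, add_mul]
    exact N.add_mem (hp v hv) (hq v hv)
  | mul_X p i hp =>
    intro v hv
    rw [map_mul, MvPolynomial.aeval_X, mul_assoc]
    exact hp _ (hN i v hv)

/-- Trade `e_d` of the tail for powers of `y 0`: modulo `N`, `y₀ e_d(tail) ≡ -e_{d+1}(tail)`, and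
the chain starts at `e_{t+1}(tail) = 0`. The case `j = s` supplies the one relation that
straightening lacks when the counter does not drop. -/
theorem pow_mul_elemSym_tail_mem {A : Type*} [CommRing A] [Algebra ℚ A] {t s : ℕ}
    (y : Fin (t + 1) → A) (N : Submodule ℚ A) (u : A) (hN : ∀ i, ∀ v ∈ N, y i * v ∈ N)
    (he : ∀ d, t + 2 ≤ d + s → elemSym y d * u ∈ N) (j : ℕ) :
    ∀ d, j ≤ s → j + d = t + 1 → y 0 ^ j * elemSym (Fin.tail y) d * u ∈ N := by
  induction j with
  | zero =>
    intro d _ hd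
    rw [elemSym_eq_zero _ (by omega)]
    simp
  | succ j ih =>
    intro d hj hd
    have h1 := aeval_mul_mem y N hN (MvPolynomial.X 0 ^ j) _ (he (d + 1) (by omega))
    have h2 := ih (d + 1) (by omega) (by omega)
    have h3 := N.sub_mem h1 h2
    rw [map_pow, MvPolynomial.aeval_X, elemSym_succ] at h3
    convert h3 using 1
    ring

/-- Straightening: modulo relations of the type `yᵢ ^ k = 0` and `e_d(y) = 0` for `d > t - s`,
every polynomial in `y` is a combination of standard monomials. -/
theorem aeval_mul_mem_sup_span {A : Type*} [CommRing A] [Algebra ℚ A] (k : ℕ) {t : ℕ}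
    (y : Fin t → A) (s : ℕ) (N : Submodule ℚ A) (u : A) (hN : ∀ i, ∀ v ∈ N, y i * v ∈ N)
    (hk : ∀ i, y i ^ k * u ∈ N) (he : ∀ d, t + 1 ≤ d + s → elemSym y d * u ∈ N)
    (f : MvPolynomial (Fin t) ℚ) :
    MvPolynomial.aeval y f * u ∈
      N ⊔ Submodule.span ℚ ((fun m : Fin t → ℕ => (∏ i, y i ^ m i) * u) '' stdExp k t s) := by
  induction t generalizing s N u with
  | zero =>
    obtain ⟨c, rfl⟩ := MvPolynomial.C_surjective (Fin 0) f
    rw [MvPolynomial.aeval_C, ← Algebra.smul_def]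
    refine Submodule.smul_mem _ _ ?_
    by_cases hs : s = 0
    · refine Submodule.mem_sup_right (Submodule.subset_span ⟨Fin.elim0, ?_, by simp⟩)
      simp [stdExp, hs]
    · have := he 0 (by omega)
      rw [elemSym_zero, one_mul] at this
      exact Submodule.mem_sup_left this
  | succ t ih =>
    set T := N ⊔ Submodule.span ℚ
      ((fun m : Fin (t + 1) → ℕ => (∏ i, y i ^ m i) * u) '' stdExp k (t + 1) s) with hT
    -- Filter by powers of `y 0`, downwards from `y 0 ^ k * u ∈ N`.
    suffices H : ∀ j ≤ k, ∀ f, MvPolynomial.aeval y f * (y 0 ^ (k - j) * u) ∈ T by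
      simpa using H k le_rfl f
    intro j
    induction j with
    | zero =>
      intro _ f
      exact Submodule.mem_sup_left (aeval_mul_mem y N hN f _ (hk 0))
    | succ j ihj =>
      intro hj f
      set c := k - (j + 1) with hc
      have hc1 : k - j = c + 1 := by omega
      have hck : c < k := by omega
      have ihj := ihj (by omega)
      rw [hc1] at ihj
      let φ : MvPolynomial (Fin (t + 1)) ℚ →ₗ[ℚ] A :=
        (LinearMap.mulRight ℚ (y 0 ^ (c + 1) * u)).comp (MvPolynomial.aeval y).toLinearMap
      have hφ : ∀ f, φ f = MvPolynomial.aeval y f * (y 0 ^ (c + 1) * u) := fun f => rfl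
      -- Modulo `N'`, `y 0` kills `y 0 ^ c * u`. Only the tail variables still act on it, and
      -- `e_d(y)` becomes `e_d(tail)`; this is the inductive situation with `y 0 ^ c * u` for `u`.
      set N' := N ⊔ LinearMap.range φ with hN'
      have hN'T : N' ≤ T := by
        refine sup_le le_sup_left ?_
        rintro _ ⟨f, rfl⟩
        exact ihj f
      have hclosed : ∀ i, ∀ v ∈ N', y i * v ∈ N' := by
        intro i v hv
        obtain ⟨v1, h1, _, ⟨g, rfl⟩, rfl⟩ := Submodule.mem_sup.1 hv
        rw [mul_add]
        refine Submodule.add_mem_sup (hN i _ h1) ⟨MvPolynomial.X i * g, ?_⟩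
        rw [hφ, hφ, map_mul, MvPolynomial.aeval_X, mul_assoc]
      have hpow : ∀ c', ∀ v ∈ N, y 0 ^ c' * v ∈ N := by
        intro c' v hv
        simpa using aeval_mul_mem y N hN (MvPolynomial.X 0 ^ c') v hv
      have hmain : ∀ d, t + 2 ≤ d + s → elemSym (Fin.tail y) d * (y 0 ^ c * u) ∈ N' := by
        intro d hd
        rcases d with _ | d
        · refine Submodule.mem_sup_left ?_
          have := hpow c _ (he 0 hd)
          rw [elemSym_zero] at this ⊢
          convert this using 1
          ring
        · have h1 := hpow c _ (he (d + 1) hd)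
          have h2 : φ (elemSym (fun i : Fin t => MvPolynomial.X i.succ) d) ∈
            LinearMap.range φ := ⟨_, rfl⟩
          rw [hφ, ← RingHom.coe_coe, map_elemSym] at h2
          simp only [RingHom.coe_coe, MvPolynomial.aeval_X] at h2
          have h3 := Submodule.add_mem_sup h1 (Submodule.neg_mem _ h2)
          rw [elemSym_succ] at h3
          convert h3 using 1
          change _ = _ + -(elemSym (Fin.tail y) d * _)
          ring
      have key := fun g => ih (Fin.tail y) (if c < s then s - 1 else s) N' (y 0 ^ c * u)
        (fun i => hclosed i.succ)
        (fun i => by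
          refine Submodule.mem_sup_left ?_
          convert hpow c _ (hk i.succ) using 1
          simp only [Fin.tail]
          ring)
        (fun d hd => by
          split_ifs at hd with hcs
          · exact hmain d (by omega)
          -- Keeping the counter at `s` requires one further relation, `d = t + 1 - s`; it holds
          -- because `y 0 ^ s` divides `y 0 ^ c`.
          · by_cases hd2 : t + 2 ≤ d + s
            · exact hmain d hd2
            · refine Submodule.mem_sup_left ?_
              have := hpow (c - s) _ (pow_mul_elemSym_tail_mem y N u hN
                (fun d hd => he d (by omega)) s d le_rfl (by omega))
              convert this using 1
              rw [show y 0 ^ c = y 0 ^ (c - s) * y 0 ^ s by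
                rw [← pow_add, Nat.sub_add_cancel (not_lt.1 hcs)]]
              ring) g
      have hle : N' ⊔ Submodule.span ℚ ((fun m : Fin t → ℕ =>
          (∏ i, Fin.tail y i ^ m i) * (y 0 ^ c * u)) ''
            stdExp k t (if c < s then s - 1 else s)) ≤ T := by
        refine sup_le hN'T (Submodule.span_le.2 ?_)
        rintro _ ⟨m, hm, rfl⟩
        refine Submodule.mem_sup_right (Submodule.subset_span ⟨Fin.cons c m, ?_, ?_⟩)
        · exact mem_stdExp_succ.2 ⟨hck, hm⟩
        · simp only [Fin.prod_univ_succ, Fin.cons_zero, Fin.cons_succ, Fin.tail]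
          ring
      obtain ⟨g, h, rfl⟩ := exists_eq_rename_succ_add f
      rw [map_add, add_mul, MvPolynomial.aeval_rename]
      refine T.add_mem (hle (key g)) ?_
      convert ihj h using 1
      rw [map_mul, MvPolynomial.aeval_X]
      ring

/-! ### The `q`-count of standard monomials -/

/-- The generating polynomial of `stdExp k n s` by complementary degree. -/
def stdGen (k : ℕ) : ℕ → ℕ → Polynomial ℤ
  | 0, s => if s = 0 then 1 else 0
  | n + 1, s => qNumber s * stdGen k n (s - 1) + qNumber (k - s) * stdGen k n s

/-- The complementary degree of a standard exponent. -/
def stdCodeg (k : ℕ) : (n : ℕ) → ℕ → (Fin n → ℕ) → ℕ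
  | 0, _, _ => 0
  | n + 1, s, m =>
    if m 0 < s then s - 1 - m 0 + stdCodeg k n (s - 1) (Fin.tail m)
    else k - 1 - m 0 + stdCodeg k n s (Fin.tail m)

/-- A first letter below `s` contributes `0, …, s - 1` to the codegree, hence `[s]_q`; a letter in
`[s, k)` contributes `0, …, k - s - 1`, hence `[k - s]_q`. -/
theorem sum_X_pow_stdCodeg {k : ℕ} (n : ℕ) {s : ℕ} (hs : s ≤ k) :
    ∑ m ∈ stdExp k n s, (Polynomial.X : Polynomial ℤ) ^ stdCodeg k n s m = stdGen k n s := by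
  induction n generalizing s with
  | zero => by_cases h : s = 0 <;> simp [stdExp, stdGen, stdCodeg, h]
  | succ n ih =>
    rw [stdExp, Finset.sum_map, Finset.sum_sigma]
    simp only [consEmbedding_apply, stdCodeg, Fin.cons_zero, Fin.tail_cons]
    rw [← Finset.sum_range_add_sum_Ico _ hs, stdGen]
    congr 1
    · conv_rhs => rw [qNumber, ← Finset.sum_range_reflect, Finset.sum_mul]
      refine Finset.sum_congr rfl fun c hc => ?_
      have hc := Finset.mem_range.1 hc
      simp only [hc, if_true, pow_add]
      rw [← Finset.mul_sum, ih (by omega)]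
    · rw [Finset.sum_Ico_eq_sum_range]
      conv_rhs => rw [qNumber, ← Finset.sum_range_reflect, Finset.sum_mul]
      refine Finset.sum_congr rfl fun c hc => ?_
      have hc := Finset.mem_range.1 hc
      simp only [show ¬ s + c < s by omega, if_false, pow_add]
      rw [← Finset.mul_sum, ih hs, show k - 1 - (s + c) = k - s - 1 - c by omega]

/-- The `s` letters at which the counter drops have degree plus codegree `s - 1, …, 0`; each of the
other `n - s` has `k - 1`. -/
theorem sum_add_stdCodeg {k : ℕ} (n : ℕ) {s : ℕ} {m : Fin n → ℕ} (hm : m ∈ stdExp k n s) :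
    s ≤ n ∧ ∑ i, m i + stdCodeg k n s m = (n - s) * (k - 1) + ∑ j ∈ Finset.range s, j := by
  induction n generalizing s with
  | zero =>
    by_cases h : s = 0
    · subst h
      simp [stdCodeg]
    · simp [stdExp, h] at hm
  | succ n ih =>
    obtain ⟨h0, hm⟩ := mem_stdExp_succ.1 hm
    rw [Fin.sum_univ_succ, stdCodeg]
    by_cases h : m 0 < s
    · rw [if_pos h] at hm ⊢
      obtain ⟨s, rfl⟩ : ∃ e, s = e + 1 := ⟨s - 1, by omega⟩
      obtain ⟨h1, h2⟩ := ih hm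
      simp only [Nat.add_sub_cancel, Fin.tail] at h1 h2 ⊢
      rw [Finset.sum_range_succ, Nat.add_sub_add_right]
      exact ⟨by omega, by omega⟩
    · rw [if_neg h] at hm ⊢
      obtain ⟨h1, h2⟩ := ih hm
      simp only [Fin.tail] at h2 ⊢
      rw [Nat.sub_add_comm h1, add_mul, one_mul]
      exact ⟨by omega, by omega⟩

theorem qNumber_succ (m : ℕ) : qNumber (m + 1) = qNumber m + Polynomial.X ^ m :=
  Finset.sum_range_succ _ _

theorem qNumber_succ' (m : ℕ) : qNumber (m + 1) = 1 + Polynomial.X * qNumber m := by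
  rw [qNumber, Finset.sum_range_succ', qNumber, Finset.mul_sum, add_comm, pow_zero]
  simp only [pow_succ']

theorem qNumber_zero : qNumber 0 = 0 := Finset.sum_range_zero _

/-- Only `s = k` is used later, where it matches the `q`-Stirling recursion; the induction needs all
`s ≤ k` because the recursion in `n` lowers the counter. -/
theorem stdGen_succ_left {k : ℕ} (n : ℕ) {s : ℕ} (hs : s ≤ k) :
    stdGen (k + 1) n s = stdGen k n s + Polynomial.X ^ (k - s) * stdGen (k + 1) n (s + 1) := by
  induction n generalizing s with
  | zero => simp [stdGen]
  | succ n ih =>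
    simp only [stdGen, Nat.add_sub_cancel, Nat.add_sub_add_right]
    rw [Nat.sub_add_comm hs, qNumber_succ, qNumber_succ' s, ih hs]
    have h1 : qNumber (k - s) * stdGen (k + 1) n s = qNumber (k - s) * (stdGen k n s +
        Polynomial.X ^ (k - s) * stdGen (k + 1) n (s + 1)) := by
      rw [← ih hs]
    rcases s with _ | s
    · rw [qNumber_zero]
      linear_combination h1 - qNumber k * ih hs
    · have h2 := ih (s := s) (by omega)
      rw [show k - s = k - (s + 1) + 1 by omega] at h2
      simp only [Nat.add_sub_cancel]
      rw [h2, ih hs]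
      ring

theorem stdGen_self (n k : ℕ) : stdGen k n k = qFactorial k * qStirling n k := by
  induction n generalizing k with
  | zero => rcases k with _ | k <;> simp [stdGen, qStirling, qFactorial]
  | succ n ih =>
    rcases k with _ | k
    · simp [stdGen, qStirling, qNumber_zero]
    · rw [stdGen, Nat.add_sub_cancel, Nat.sub_self, qNumber_zero, zero_mul, add_zero,
        stdGen_succ_left n le_rfl, Nat.sub_self, pow_zero, one_mul, ih, ih, qStirling,
        show qFactorial (k + 1) = qFactorial k * qNumber (k + 1) from Finset.prod_range_succ _ _]
      ring

/-! ### Differential operators and the annihilator of the Vandermonde -/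

section

variable {n : ℕ}

theorem pderiv_comm (i j : Fin n) (f : MvPolynomial (Fin n) ℚ) :
    MvPolynomial.pderiv i (MvPolynomial.pderiv j f) =
      MvPolynomial.pderiv j (MvPolynomial.pderiv i f) := by
  let D : Fin n → Derivation ℚ (MvPolynomial (Fin n) ℚ) (MvPolynomial (Fin n) ℚ) :=
    fun i => MvPolynomial.pderiv i
  have h : ⁅D i, D j⁆ = 0 := by
    refine MvPolynomial.derivation_ext fun l => ?_
    simp [D, Derivation.commutator_apply, MvPolynomial.pderiv_X, Pi.single_apply, apply_ite]
  have h2 := Derivation.congr_fun h f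
  rwa [Derivation.commutator_apply, Derivation.zero_apply, sub_eq_zero] at h2

theorem partialX_mul_comm (i j : Fin n) :
    (partialX i : Module.End ℚ (Superspace n)) * partialX j = partialX j * partialX i := by
  refine TensorProduct.ext' fun f ω => ?_
  simp [partialX, pderiv_comm i j f]

open scoped IsMulCommutative in
/-- Polynomials act on superspace as differential operators, the variable `i` by `∂ᵢ`. -/
def act (n : ℕ) : MvPolynomial (Fin n) ℚ →ₐ[ℚ] Module.End ℚ (Superspace n) :=
  -- `MvPolynomial.aeval` needs a commutative target, so evaluation takes place in the subalgebra
  -- generated by the commuting `∂ᵢ`.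
  haveI := Algebra.isMulCommutative_adjoin ℚ
    (s := Set.range (partialX : Fin n → Module.End ℚ (Superspace n))) (by
      rintro _ ⟨i, rfl⟩ _ ⟨j, rfl⟩
      exact partialX_mul_comm i j)
  (Algebra.adjoin ℚ (Set.range (partialX : Fin n → Module.End ℚ (Superspace n)))).val.comp
    (MvPolynomial.aeval fun i => ⟨partialX i, Algebra.subset_adjoin ⟨i, rfl⟩⟩)

theorem act_X (i : Fin n) : act n (MvPolynomial.X i) = partialX i := by
  simp [act]

theorem act_mul_apply (f g : MvPolynomial (Fin n) ℚ) (v : Superspace n) :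
    act n (f * g) v = act n f (act n g v) := by
  rw [map_mul, Module.End.mul_apply]

/-- The superpolynomial `x₁^{p₁} ⋯ xₙ^{pₙ} ⊗ ω`. -/
def mono (p : Fin n → ℕ) (ω : ExteriorAlgebra ℚ (Fin n → ℚ)) : Superspace n :=
  MvPolynomial.monomial (Finsupp.equivFunOnFinite.symm p) 1 ⊗ₜ[ℚ] ω

/-- Truncated subtraction is harmless: the coefficient vanishes when `p i = 0`. -/
theorem partialX_mono (i : Fin n) (p : Fin n → ℕ) (ω : ExteriorAlgebra ℚ (Fin n → ℚ)) :
    partialX i (mono p ω) = (p i : ℚ) • mono (p - Pi.single i 1) ω := by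
  rw [mono, mono, partialX, TensorProduct.map_tmul, TensorProduct.smul_tmul']
  congr 1
  change MvPolynomial.pderiv i _ = _
  rw [MvPolynomial.pderiv_monomial, MvPolynomial.smul_monomial]
  congr 1
  · congr 1
    ext j
    by_cases h : i = j
    · subst h
      simp
    · simp [Ne.symm h]
  · simp

theorem act_X_pow_mono (i : Fin n) (c : ℕ) (p : Fin n → ℕ)
    (ω : ExteriorAlgebra ℚ (Fin n → ℚ)) :
    act n (MvPolynomial.X i ^ c) (mono p ω) =
      ((p i).descFactorial c : ℚ) • mono (p - Pi.single i c) ω := by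
  induction c with
  | zero => simp
  | succ c ih =>
    rw [pow_succ', act_mul_apply, ih, map_smul, act_X, partialX_mono, smul_smul, tsub_tsub,
      ← Pi.single_add, Nat.descFactorial_succ]
    simp [mul_comm]

theorem act_prod_mono (s : Finset (Fin n)) (m p : Fin n → ℕ)
    (ω : ExteriorAlgebra ℚ (Fin n → ℚ)) :
    act n (∏ i ∈ s, MvPolynomial.X i ^ m i) (mono p ω) =
      ((∏ i ∈ s, (p i).descFactorial (m i) : ℕ) : ℚ) • mono (p - s.piecewise m 0) ω := by
  induction s using Finset.induction_on with
  | empty => simp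
  | insert i s hi ih =>
    rw [Finset.prod_insert hi, act_mul_apply, ih, map_smul, act_X_pow_mono, smul_smul,
      Finset.prod_insert hi]
    have h1 : (p - s.piecewise m 0) i = p i := by simp [hi]
    have h2 : p - s.piecewise m 0 - Pi.single i (m i) = p - (insert i s).piecewise m 0 := by
      ext j
      by_cases h : j = i
      · subst h
        simp [hi]
      · by_cases hj : j ∈ s <;> simp [h, hj]
    rw [h1, h2, Nat.cast_mul, mul_comm]

variable {k r : ℕ}

/-- The exterior monomial `θ_{w(1)} ⋯ θ_{w(r)}`. -/
def thetaPerm (w : Equiv.Perm (Fin (r + k))) : ExteriorAlgebra ℚ (Fin (r + k) → ℚ) :=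
  ExteriorAlgebra.ιMulti ℚ r fun i => Pi.single (w (Fin.castAdd k i)) 1

/-- The antisymmetrization of `x₁^{p₁} ⋯ xₙ^{pₙ} θ₁ ⋯ θ_r`. -/
def alternant (k r : ℕ) (p : Fin (r + k) → ℕ) : Superspace (r + k) :=
  ∑ w : Equiv.Perm (Fin (r + k)),
    ((Equiv.Perm.sign w : ℤ) : ℚ) • mono (p ∘ w.symm) (thetaPerm w)

/-- The exponent `(a₁, …, a_r, k - 1, …, 1, 0)`. -/
def vanExp (k r : ℕ) (a : Fin r → ℕ) : Fin (r + k) → ℕ :=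
  Fin.append a fun j => k - 1 - (j : ℕ)

theorem monomial_equivFunOnFinite_symm (p : Fin n → ℕ) :
    (MvPolynomial.monomial (Finsupp.equivFunOnFinite.symm p) 1 : MvPolynomial (Fin n) ℚ) =
      ∏ i, MvPolynomial.X i ^ p i := by
  rw [MvPolynomial.monomial_eq, Finsupp.prod_fintype _ _ (by simp)]
  simp

theorem permAct_mono_thetaPerm (p : Fin (r + k) → ℕ) (w : Equiv.Perm (Fin (r + k))) :
    permAct w (mono p (thetaPerm (1 : Equiv.Perm (Fin (r + k))))) =
      mono (p ∘ w.symm) (thetaPerm w) := by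
  rw [mono, mono, permAct, Algebra.TensorProduct.map_tmul]
  congr 1
  · rw [monomial_equivFunOnFinite_symm, monomial_equivFunOnFinite_symm, map_prod]
    simp only [map_pow, MvPolynomial.rename_X]
    conv_rhs => rw [← Equiv.prod_comp w]
    simp
  · rw [thetaPerm, thetaPerm, ExteriorAlgebra.map_apply_ιMulti]
    congr 1
    ext i j
    simp [LinearMap.funLeft_apply, Pi.single_apply, Equiv.symm_apply_eq]

theorem vandermonde_eq_alternant (a : Fin r → ℕ) :
    vandermonde k r a = alternant k r (vanExp k r a) := by
  have h : (List.ofFn fun i : Fin r => x (Fin.castAdd k i) ^ a i).prod *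
      (List.ofFn fun j : Fin k => x (Fin.natAdd r j) ^ (k - 1 - (j : ℕ))).prod *
      (List.ofFn fun i : Fin r => theta (Fin.castAdd k i)).prod =
      mono (vanExp k r a) (thetaPerm (1 : Equiv.Perm (Fin (r + k)))) := by
    have hx : ∀ (i : Fin (r + k)) (c : ℕ), (x i ^ c : Superspace (r + k)) =
        Algebra.TensorProduct.includeLeft (R := ℚ) (S := ℚ) (MvPolynomial.X i ^ c) := by
      intro i c
      rw [map_pow]
      rfl
    have ht : ∀ i : Fin (r + k), (theta i : Superspace (r + k)) =
        Algebra.TensorProduct.includeRight (R := ℚ)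
          (ExteriorAlgebra.ι ℚ (Pi.single i 1 : Fin (r + k) → ℚ)) := fun i => rfl
    simp only [hx, ht]
    rw [← Function.comp_def (g := fun i : Fin r => MvPolynomial.X (Fin.castAdd k i) ^ a i),
      ← List.map_ofFn, ← map_list_prod,
      ← Function.comp_def
        (g := fun j : Fin k => MvPolynomial.X (Fin.natAdd r j) ^ (k - 1 - (j : ℕ))),
      ← List.map_ofFn, ← map_list_prod, ← map_mul, List.prod_ofFn, List.prod_ofFn,
      ← Function.comp_def (g := fun i : Fin r =>
        ExteriorAlgebra.ι ℚ (Pi.single (Fin.castAdd k i) 1 : Fin (r + k) → ℚ)),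
      ← List.map_ofFn, ← map_list_prod, Algebra.TensorProduct.includeLeft_apply,
      Algebra.TensorProduct.includeRight_apply, Algebra.TensorProduct.tmul_mul_tmul, mul_one,
      one_mul, mono, monomial_equivFunOnFinite_symm, Fin.prod_univ_add]
    simp [vanExp, thetaPerm, ExteriorAlgebra.ιMulti_apply]
  rw [vandermonde, h, antisymm, alternant]
  simp only [permAct_mono_thetaPerm]

/-- Swapping the two positions fixes both the monomial and `θ₁ ⋯ θ_r`, so `w ↦ w * swap` is a
sign-reversing involution on the terms. -/
theorem alternant_eq_zero (p : Fin (r + k) → ℕ) {i j : Fin k} (hij : i ≠ j)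
    (hp : p (Fin.natAdd r i) = p (Fin.natAdd r j)) : alternant k r p = 0 := by
  have hne : Fin.natAdd r i ≠ Fin.natAdd r j := fun h => hij (Fin.natAdd_inj r |>.1 h)
  have hps : p ∘ Equiv.swap (Fin.natAdd r i) (Fin.natAdd r j) = p := by
    funext l
    simp only [Function.comp_apply]
    rcases eq_or_ne l (Fin.natAdd r i) with rfl | h1
    · rw [Equiv.swap_apply_left, hp]
    rcases eq_or_ne l (Fin.natAdd r j) with rfl | h2
    · rw [Equiv.swap_apply_right, hp]
    rw [Equiv.swap_apply_of_ne_of_ne h1 h2]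
  refine Finset.sum_involution
    (fun w _ => w * Equiv.swap (Fin.natAdd r i) (Fin.natAdd r j)) ?_ ?_ ?_ ?_
  · intro w _
    have h1 : p ∘ (w * Equiv.swap (Fin.natAdd r i) (Fin.natAdd r j)).symm = p ∘ w.symm := by
      conv_rhs => rw [← hps]
      rfl
    have h2 : thetaPerm (w * Equiv.swap (Fin.natAdd r i) (Fin.natAdd r j)) = thetaPerm w := by
      unfold thetaPerm
      congr 1
      funext l
      rw [Equiv.Perm.mul_apply, Equiv.swap_apply_of_ne_of_ne]
      · exact fun h => by simpa [Fin.ext_iff] using l.2.trans_le (le_of_le_of_eq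
          (Nat.le_add_right r i) (congrArg Fin.val h).symm)
      · exact fun h => by simpa [Fin.ext_iff] using l.2.trans_le (le_of_le_of_eq
          (Nat.le_add_right r j) (congrArg Fin.val h).symm)
    rw [h1, h2, Equiv.Perm.sign_mul, Equiv.Perm.sign_swap hne, ← add_smul]
    simp
  · intro w _ _ h
    exact hne (Equiv.swap_eq_one_iff.1 (mul_eq_left.1 h))
  · simp
  · intro w _
    rw [mul_assoc, Equiv.swap_mul_self, mul_one]

/-- The operator `e_d(∂)` is symmetric, so it can be applied inside the antisymmetrization. -/
theorem act_elemSym_alternant (p : Fin (r + k) → ℕ) (d : ℕ) :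
    act (r + k) (elemSym MvPolynomial.X d) (alternant k r p) =
      ∑ s : Finset (Fin (r + k)), if s.card = d then
        ((∏ i ∈ s, p i : ℕ) : ℚ) • alternant k r (p - s.piecewise 1 0) else 0 := by
  have hterm : ∀ (w : Equiv.Perm (Fin (r + k))) (s : Finset (Fin (r + k))),
      act (r + k) (∏ i ∈ s.map w.toEmbedding, MvPolynomial.X i)
        (mono (p ∘ w.symm) (thetaPerm w)) =
      ((∏ i ∈ s, p i : ℕ) : ℚ) • mono ((p - s.piecewise 1 0) ∘ w.symm) (thetaPerm w) := by
    intro w s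
    have h := act_prod_mono (s.map w.toEmbedding) 1 (p ∘ w.symm) (thetaPerm w)
    simp only [Pi.one_apply, pow_one, Nat.descFactorial_one] at h
    rw [h, Finset.prod_map]
    congr 2
    · simp
    · funext l
      by_cases hl : w.symm l ∈ s <;> simp [Finset.piecewise, hl, Finset.mem_map_equiv]
  have hL : act (r + k) (elemSym MvPolynomial.X d) (alternant k r p) =
      ∑ w : Equiv.Perm (Fin (r + k)), ∑ s : Finset (Fin (r + k)), if s.card = d then
        ((Equiv.Perm.sign w : ℤ) : ℚ) • act (r + k) (∏ i ∈ s, MvPolynomial.X i)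
          (mono (p ∘ w.symm) (thetaPerm w)) else 0 := by
    rw [elemSym_eq_sum, alternant, map_sum]
    refine Finset.sum_congr rfl fun w _ => ?_
    rw [map_smul, map_sum, LinearMap.sum_apply, Finset.smul_sum]
    refine Finset.sum_congr rfl fun s _ => ?_
    split_ifs <;> simp
  have hR : (∑ s : Finset (Fin (r + k)), if s.card = d then
        ((∏ i ∈ s, p i : ℕ) : ℚ) • alternant k r (p - s.piecewise 1 0) else 0) =
      ∑ w : Equiv.Perm (Fin (r + k)), ∑ s : Finset (Fin (r + k)), if s.card = d then
        ((Equiv.Perm.sign w : ℤ) : ℚ) • ((∏ i ∈ s, p i : ℕ) : ℚ) •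
          mono ((p - s.piecewise 1 0) ∘ w.symm) (thetaPerm w) else 0 := by
    rw [Finset.sum_comm]
    refine Finset.sum_congr rfl fun s _ => ?_
    split_ifs
    · rw [alternant, Finset.smul_sum]
      exact Finset.sum_congr rfl fun w _ => smul_comm _ _ _
    · simp
  rw [hL, hR]
  refine Finset.sum_congr rfl fun w _ => ?_
  rw [← Equiv.sum_comp w.finsetCongr]
  refine Finset.sum_congr rfl fun s _ => ?_
  rw [Equiv.finsetCongr_apply, Finset.card_map, hterm]

/-- A set of `d > r` positions meets the staircase. Lowering the exponent at the last staircase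
position it contains produces a repeat of the next exponent, hence a zero alternant; at the end of
the staircase it differentiates `x^0`. -/
theorem act_elemSym_vandermonde (a : Fin r → ℕ) {d : ℕ} (hd : r < d) :
    act (r + k) (elemSym MvPolynomial.X d) (vandermonde k r a) = 0 := by
  rw [vandermonde_eq_alternant, act_elemSym_alternant]
  refine Finset.sum_eq_zero fun s _ => ?_
  split_ifs with hs
  swap
  · rfl
  set J : Finset (Fin k) := {j | Fin.natAdd r j ∈ s} with hJ
  have hne : J.Nonempty := by
    by_contra hcon
    have hsub : s ⊆ Finset.univ.image (Fin.castAdd k : Fin r → Fin (r + k)) := by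
      intro i hi
      induction i using Fin.addCases with
      | left i => simp
      | right j => exact absurd ⟨j, by simpa [hJ] using hi⟩ hcon
    have := (Finset.card_le_card hsub).trans Finset.card_image_le
    simp only [Finset.card_univ, Fintype.card_fin] at this
    omega
  obtain ⟨j, hjJ, hmax⟩ := J.exists_max_image id hne
  have hj : Fin.natAdd r j ∈ s := by simpa [hJ] using hjJ
  by_cases hlast : (j : ℕ) + 1 < k
  · have hj' : Fin.natAdd r (⟨j + 1, hlast⟩ : Fin k) ∉ s := fun h => by
      have := hmax ⟨j + 1, hlast⟩ (by simpa [hJ] using h)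
      simp [Fin.le_def] at this
    rw [alternant_eq_zero (i := j) (j := ⟨j + 1, hlast⟩) _ (by simp [Fin.ext_iff]), smul_zero]
    simp only [Pi.sub_apply, vanExp, Fin.append_right, Finset.piecewise_eq_of_mem _ _ _ hj,
      Finset.piecewise_eq_of_notMem _ _ _ hj', Pi.one_apply, Pi.zero_apply]
    omega
  · rw [Finset.prod_eq_zero hj, Nat.cast_zero, zero_smul]
    simp only [vanExp, Fin.append_right]
    omega

theorem vanExp_lt {a : Fin r → ℕ} (ha : ∀ i, a i < k) (i : Fin (r + k)) : vanExp k r a i < k := by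
  induction i using Fin.addCases with
  | left i => simpa [vanExp] using ha i
  | right j =>
    simp only [vanExp, Fin.append_right]
    omega

theorem act_X_pow_vandermonde {a : Fin r → ℕ} (ha : ∀ i, a i < k) (i : Fin (r + k)) :
    act (r + k) (MvPolynomial.X i ^ k) (vandermonde k r a) = 0 := by
  rw [vandermonde_eq_alternant, alternant, map_sum]
  refine Finset.sum_eq_zero fun w _ => ?_
  rw [map_smul, act_X_pow_mono, Function.comp_apply,
    Nat.descFactorial_eq_zero_iff_lt.2 (vanExp_lt ha _)]
  simp

end

/-! ### Linear independence by lexicographic triangularity -/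

section

/-- Take for `g j` the position where the counter drops from `s - j`; the letter there is below `s -
j`. -/
theorem exists_strictMono_of_mem_stdExp {k n s : ℕ} {m : Fin n → ℕ} (hm : m ∈ stdExp k n s) :
    (∀ i, m i < k) ∧ ∃ g : Fin s → Fin n, StrictMono g ∧ ∀ j, m (g j) + j < s := by
  induction n generalizing s with
  | zero =>
    obtain rfl : s = 0 := by
      by_contra h
      simp [stdExp, h] at hm
    exact ⟨fun i => i.elim0, Fin.elim0, fun i => i.elim0, fun i => i.elim0⟩
  | succ n ih =>
    obtain ⟨h0, hm⟩ := mem_stdExp_succ.1 hm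
    by_cases h : m 0 < s
    · obtain ⟨s, rfl⟩ : ∃ e, s = e + 1 := ⟨s - 1, by omega⟩
      rw [if_pos h, Nat.add_sub_cancel] at hm
      obtain ⟨h1, g, hg, hgs⟩ := ih hm
      refine ⟨Fin.cases h0 h1, Fin.cons 0 fun j => (g j).succ, ?_, ?_⟩
      · intro i j
        refine Fin.cases ?_ (fun i => ?_) i <;> refine Fin.cases ?_ (fun j => ?_) j
        · simp
        · simp
        · simp
        · intro hij
          simpa using hg (Fin.succ_lt_succ_iff.1 hij)
      · refine Fin.cases (by simpa using h) fun j => ?_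
        have := hgs j
        simp only [Fin.tail] at this
        simp only [Fin.cons_succ, Fin.val_succ]
        omega
    · rw [if_neg h] at hm
      obtain ⟨h1, g, hg, hgs⟩ := ih hm
      exact ⟨Fin.cases h0 h1, fun j => (g j).succ, fun i j hij => by simpa using hg hij, hgs⟩

variable {k r : ℕ}

theorem exists_perm_apply_natAdd (g : Fin k → Fin (r + k)) (hg : Function.Injective g) :
    ∃ w : Equiv.Perm (Fin (r + k)), ∀ j, w (Fin.natAdd r j) = g j := by
  obtain ⟨w, hw⟩ := (Equiv.Perm.isMultiplyPretransitive (Fin (r + k)) k).exists_smul_eq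
    (Fin.natAddEmb r) ⟨g, hg⟩
  exact ⟨w, fun j => DFunLike.congr_fun hw j⟩

/-- The linear form extracting the coefficient of `θ_{w(1)} ⋯ θ_{w(r)}`. -/
def minor (w : Equiv.Perm (Fin (r + k))) :
    ExteriorAlgebra ℚ (Fin (r + k) → ℚ) →ₗ[ℚ] ℚ :=
  ExteriorAlgebra.liftAlternating (Pi.single r (Matrix.detRowAlternating.compLinearMap
    (LinearMap.funLeft ℚ ℚ (w ∘ Fin.castAdd k))))

theorem minor_thetaPerm (w₀ w : Equiv.Perm (Fin (r + k))) :
    minor w₀ (thetaPerm w) = Matrix.det (Matrix.of fun i l : Fin r =>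
      (Pi.single (w (Fin.castAdd k i)) 1 : Fin (r + k) → ℚ) (w₀ (Fin.castAdd k l))) := by
  rw [minor, thetaPerm, ExteriorAlgebra.liftAlternating_apply_ιMulti, Pi.single_eq_same]
  rfl

theorem minor_thetaPerm_self (w : Equiv.Perm (Fin (r + k))) : minor w (thetaPerm w) = 1 := by
  rw [minor_thetaPerm, ← Matrix.det_one (n := Fin r)]
  congr 1
  ext i l
  simp [Pi.single_apply, Matrix.one_apply, eq_comm]

/-- A nonzero minor forces `w` and `w₀` to have the same image on the first `r` indices, hence on
the last `k`. -/
theorem exists_natAdd_of_minor_ne_zero {w₀ w : Equiv.Perm (Fin (r + k))}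
    (h : minor w₀ (thetaPerm w) ≠ 0) (j : Fin k) :
    ∃ j', w (Fin.natAdd r j') = w₀ (Fin.natAdd r j) := by
  have hl : ∀ l : Fin r, ∃ i : Fin r, w (Fin.castAdd k i) = w₀ (Fin.castAdd k l) := by
    intro l
    by_contra! hcon
    refine h ?_
    rw [minor_thetaPerm]
    refine Matrix.det_eq_zero_of_column_eq_zero l fun i => ?_
    simp [Pi.single_apply, (hcon i).symm]
  choose f hf using hl
  have hinj : Function.Injective f := by
    intro a b hab
    have := hf a
    rw [hab, hf b] at this
    simpa using this.symm
  generalize hi : w.symm (w₀ (Fin.natAdd r j)) = i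
  have hi : w i = w₀ (Fin.natAdd r j) := by simp [← hi]
  induction i using Fin.addCases with
  | left i =>
    obtain ⟨l, rfl⟩ := Finite.injective_iff_surjective.1 hinj i
    rw [hf l] at hi
    have := congrArg Fin.val (w₀.injective hi)
    simp at this
    omega
  | right j' => exact ⟨j', hi⟩

/-- Here `w` is `w₀` times a permutation `σ` of the first `r` indices, and `sign σ` enters both
factors. The product therefore does not depend on `w`, which rules out cancellation in the
coefficients below. -/
theorem sign_mul_minor_thetaPerm {w₀ w : Equiv.Perm (Fin (r + k))}
    (h : ∀ j, w (Fin.natAdd r j) = w₀ (Fin.natAdd r j)) :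
    ((Equiv.Perm.sign w : ℤ) : ℚ) * minor w₀ (thetaPerm w) = (Equiv.Perm.sign w₀ : ℤ) := by
  obtain ⟨σ, hσ, hs⟩ : ∃ σ : Equiv.Perm (Fin r),
      (∀ i, w (Fin.castAdd k i) = w₀ (Fin.castAdd k (σ i))) ∧
        Equiv.Perm.sign w = Equiv.Perm.sign w₀ * Equiv.Perm.sign σ := by
    set u : Equiv.Perm (Fin r ⊕ Fin k) :=
      finSumFinEquiv.symm.permCongr (w₀⁻¹ * w) with hu
    have hur : ∀ j, u (Sum.inr j) = Sum.inr j := by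
      intro j
      simp [hu, Equiv.permCongr_apply, h]
    have hmaps : Set.MapsTo u (Set.range Sum.inl) (Set.range Sum.inl) := by
      rw [Equiv.Perm.perm_mapsTo_inl_iff_mapsTo_inr]
      rintro _ ⟨j, rfl⟩
      exact ⟨j, (hur j).symm⟩
    obtain ⟨⟨σ, τ⟩, hστ⟩ := Equiv.Perm.mem_sumCongrHom_range_of_perm_mapsTo_inl hmaps
    rw [Equiv.Perm.sumCongrHom_apply] at hστ
    have hτ : τ = 1 := by
      ext j
      have := hur j
      rw [← hστ] at this
      simpa [Fin.ext_iff] using this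
    refine ⟨σ, fun i => ?_, ?_⟩
    · have h1 : u (Sum.inl i) = Sum.inl (σ i) := by rw [← hστ]; rfl
      rw [hu, Equiv.permCongr_apply, Equiv.symm_apply_eq] at h1
      simp only [Equiv.symm_symm, finSumFinEquiv_apply_left, Equiv.Perm.mul_apply] at h1
      rw [← h1]
      simp
    · have h1 : Equiv.Perm.sign u = Equiv.Perm.sign σ := by
        rw [← hστ, hτ]
        change Equiv.Perm.sign (Equiv.Perm.sumCongr σ 1) = _
        rw [Equiv.Perm.sign_sumCongr, Equiv.Perm.sign_one, mul_one]
      rw [hu, Equiv.Perm.sign_permCongr, Equiv.Perm.sign_mul, Equiv.Perm.sign_inv] at h1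
      rw [← h1, ← mul_assoc, Int.units_mul_self, one_mul]
  have ht : thetaPerm w = Equiv.Perm.sign σ • thetaPerm w₀ := by
    rw [thetaPerm, thetaPerm, ← AlternatingMap.map_perm]
    congr 1
    funext i
    simp [hσ]
  rw [ht, hs, Units.smul_def, map_zsmul, minor_thetaPerm_self]
  rcases Int.units_eq_one_or (Equiv.Perm.sign σ) with h1 | h1 <;> simp [h1]

/-- The linear form extracting the coefficient of `x₁^{e₁} ⋯ xₙ^{eₙ} θ_{w(1)} ⋯ θ_{w(r)}`. -/
def coeffMinor (w : Equiv.Perm (Fin (r + k))) (e : Fin (r + k) → ℕ) :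
    Superspace (r + k) →ₗ[ℚ] ℚ :=
  TensorProduct.lift ((LinearMap.mul ℚ ℚ).compl₁₂
    (MvPolynomial.lcoeff (R := ℚ) (Finsupp.equivFunOnFinite.symm e)) (minor w))

theorem coeffMinor_mono (w : Equiv.Perm (Fin (r + k))) (e p : Fin (r + k) → ℕ)
    (ω : ExteriorAlgebra ℚ (Fin (r + k) → ℚ)) :
    coeffMinor w e (mono p ω) = if p = e then minor w ω else 0 := by
  rw [coeffMinor, mono, TensorProduct.lift.tmul, LinearMap.compl₁₂_apply,
    MvPolynomial.lcoeff_apply, MvPolynomial.coeff_monomial]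
  simp

/-- The monomial `x₁^{m₁} ⋯ xₙ^{mₙ}`. -/
def xPow {n : ℕ} (m : Fin n → ℕ) : MvPolynomial (Fin n) ℚ := ∏ i, MvPolynomial.X i ^ m i

theorem act_xPow_alternant (m p : Fin (r + k) → ℕ) :
    act (r + k) (xPow m) (alternant k r p) = ∑ w : Equiv.Perm (Fin (r + k)),
      ((Equiv.Perm.sign w : ℤ) : ℚ) • ((∏ i, (p (w.symm i)).descFactorial (m i) : ℕ) : ℚ) •
        mono (p ∘ w.symm - m) (thetaPerm w) := by
  rw [alternant, map_sum]
  refine Finset.sum_congr rfl fun w _ => ?_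
  rw [map_smul, xPow, act_prod_mono, Finset.piecewise_univ]
  rfl

theorem coeffMinor_act_xPow_alternant (w₀ : Equiv.Perm (Fin (r + k)))
    (e m p : Fin (r + k) → ℕ) :
    coeffMinor w₀ e (act (r + k) (xPow m) (alternant k r p)) =
      ∑ w : Equiv.Perm (Fin (r + k)), if p ∘ w.symm - m = e then
        ((∏ i, (p (w.symm i)).descFactorial (m i) : ℕ) : ℚ) *
          (((Equiv.Perm.sign w : ℤ) : ℚ) * minor w₀ (thetaPerm w)) else 0 := by
  rw [act_xPow_alternant, map_sum]
  refine Finset.sum_congr rfl fun w _ => ?_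
  rw [map_smul, map_smul, coeffMinor_mono]
  split_ifs
  · simp only [smul_eq_mul]
    ring
  · simp

theorem prod_descFactorial_ne_zero_iff {n : ℕ} {p m : Fin n → ℕ} :
    ∏ i, (p i).descFactorial (m i) ≠ 0 ↔ m ≤ p := by
  simp [Finset.prod_ne_zero_iff, Nat.descFactorial_eq_zero_iff_lt, Pi.le_def]

section top

variable {a : Fin r → ℕ} {w₀ w : Equiv.Perm (Fin (r + k))}

/-- For a fixed set of staircase positions, the lexicographically largest arrangement lists `k-1, …,
1, 0` from left to right; all other entries are `k - 1`, the maximum. -/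
theorem toLex_vanExp_comp_le (ha : ∀ i, a i + 1 = k)
    (hmono : StrictMono fun j => w₀ (Fin.natAdd r j))
    (hset : ∀ j, ∃ j', w (Fin.natAdd r j') = w₀ (Fin.natAdd r j)) :
    toLex (vanExp k r a ∘ w.symm) ≤ toLex (vanExp k r a ∘ w₀.symm) := by
  by_contra! hlt
  obtain ⟨i, hi, hlt⟩ := hlt
  simp only [Pi.toLex_apply, Function.comp_apply] at hi hlt
  obtain ⟨i, rfl⟩ := w₀.surjective i
  rw [Equiv.symm_apply_apply] at hlt
  induction i using Fin.addCases with
  | left i =>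
    have h1 := vanExp_lt (a := a) (k := k) (fun i => by have := ha i; omega)
      (w.symm (w₀ (Fin.castAdd k i)))
    have h2 := ha i
    simp only [vanExp, Fin.append_left] at hlt h1
    omega
  | right b' =>
    obtain ⟨b, hb⟩ := hset b'
    rw [← hb, Equiv.symm_apply_apply] at hlt
    simp only [vanExp, Fin.append_right] at hlt
    have hbb : b < b' := by
      rw [Fin.lt_def]
      omega
    -- The larger exponent `k-1-b` already occurs in the `w₀` arrangement at an earlier position.
    -- The two arrangements agree there, so `w` would use that staircase entry twice.
    have h1 := hi _ (hmono hbb)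
    obtain ⟨c, hc⟩ := hset b
    beta_reduce at h1
    rw [Equiv.symm_apply_apply, ← hc, Equiv.symm_apply_apply] at h1
    simp only [vanExp, Fin.append_right] at h1
    obtain rfl : c = b := by
      rw [Fin.ext_iff]
      omega
    rw [hc] at hb
    exact hbb.ne (Fin.natAdd_inj r |>.1 (w₀.injective hb))

theorem apply_natAdd_eq (hset : ∀ j, ∃ j', w (Fin.natAdd r j') = w₀ (Fin.natAdd r j))
    (h : vanExp k r a ∘ w.symm = vanExp k r a ∘ w₀.symm) (j : Fin k) :
    w (Fin.natAdd r j) = w₀ (Fin.natAdd r j) := by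
  obtain ⟨j', hj'⟩ := hset j
  have h1 := congrFun h (w₀ (Fin.natAdd r j))
  simp only [Function.comp_apply, Equiv.symm_apply_apply, ← hj'] at h1
  rw [hj', Equiv.symm_apply_apply] at h1
  simp only [vanExp, Fin.append_right] at h1
  obtain rfl : j' = j := by
    rw [Fin.ext_iff]
    omega
  exact hj'

/-- Contributing `w` give the same arrangement as `w₀`, hence agree with it on the staircase; their
terms all carry the sign of `w₀` and add up. -/
theorem coeffMinor_act_xPow_self_ne_zero {m : Fin (r + k) → ℕ}
    (hm : m ≤ vanExp k r a ∘ w₀.symm) :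
    coeffMinor w₀ (vanExp k r a ∘ w₀.symm - m)
      (act (r + k) (xPow m) (alternant k r (vanExp k r a))) ≠ 0 := by
  have hterm : ∀ w : Equiv.Perm (Fin (r + k)),
      (if vanExp k r a ∘ w.symm - m = vanExp k r a ∘ w₀.symm - m then
        ((∏ i, (vanExp k r a (w.symm i)).descFactorial (m i) : ℕ) : ℚ) *
          (((Equiv.Perm.sign w : ℤ) : ℚ) * minor w₀ (thetaPerm w)) else 0) =
      ((Equiv.Perm.sign w₀ : ℤ) : ℚ) *
        (if vanExp k r a ∘ w.symm - m = vanExp k r a ∘ w₀.symm - m ∧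
          minor w₀ (thetaPerm w) ≠ 0 then
        ((∏ i, (vanExp k r a (w.symm i)).descFactorial (m i) : ℕ) : ℚ) else 0) := by
    intro w
    by_cases h1 : vanExp k r a ∘ w.symm - m = vanExp k r a ∘ w₀.symm - m
    swap
    · simp [h1]
    by_cases h2 : minor w₀ (thetaPerm w) = 0
    · simp [h2]
    by_cases h3 : ∏ i, (vanExp k r a (w.symm i)).descFactorial (m i) = 0
    · simp [h3]
    have h4 : m ≤ vanExp k r a ∘ w.symm := prod_descFactorial_ne_zero_iff.1 h3
    have h5 : vanExp k r a ∘ w.symm = vanExp k r a ∘ w₀.symm := by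
      rw [← tsub_add_cancel_of_le h4, h1, tsub_add_cancel_of_le hm]
    rw [if_pos h1, if_pos ⟨h1, h2⟩, sign_mul_minor_thetaPerm
      (apply_natAdd_eq (exists_natAdd_of_minor_ne_zero h2) h5), mul_comm]
  rw [coeffMinor_act_xPow_alternant, Finset.sum_congr rfl fun w _ => hterm w, ← Finset.mul_sum]
  refine mul_ne_zero (by exact_mod_cast (Equiv.Perm.sign w₀).ne_zero) (ne_of_gt ?_)
  refine Finset.sum_pos' (fun w _ => ?_) ⟨w₀, Finset.mem_univ _, ?_⟩
  · split_ifs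
    · positivity
    · exact le_rfl
  · rw [if_pos ⟨rfl, by rw [minor_thetaPerm_self]; exact one_ne_zero⟩]
    exact_mod_cast Nat.pos_of_ne_zero (prod_descFactorial_ne_zero_iff.2 hm)

/-- A contributing `w` would give `p ∘ w⁻¹ + m = p ∘ w₀⁻¹ + m'` for `p = vanExp k r a`, although `p
∘ w⁻¹ ≤ p ∘ w₀⁻¹` and `m < m'` lexicographically. -/
theorem coeffMinor_act_xPow_eq_zero (ha : ∀ i, a i + 1 = k)
    (hmono : StrictMono fun j => w₀ (Fin.natAdd r j)) {m m' : Fin (r + k) → ℕ}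
    (hm : m ≤ vanExp k r a ∘ w₀.symm) (hlt : toLex m < toLex m') :
    coeffMinor w₀ (vanExp k r a ∘ w₀.symm - m)
      (act (r + k) (xPow m') (alternant k r (vanExp k r a))) = 0 := by
  rw [coeffMinor_act_xPow_alternant]
  refine Finset.sum_eq_zero fun w _ => ?_
  split_ifs with h1
  swap
  · rfl
  by_cases h2 : minor w₀ (thetaPerm w) = 0
  · simp [h2]
  by_cases h3 : ∏ i, (vanExp k r a (w.symm i)).descFactorial (m' i) = 0
  · simp [h3]
  have h4 : m' ≤ vanExp k r a ∘ w.symm := prod_descFactorial_ne_zero_iff.1 h3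
  have h5 : vanExp k r a ∘ w.symm + m = vanExp k r a ∘ w₀.symm + m' := by
    rw [← tsub_add_cancel_of_le h4, h1, add_right_comm, tsub_add_cancel_of_le hm]
  have h6 := toLex_vanExp_comp_le ha hmono (exists_natAdd_of_minor_ne_zero h2)
  refine absurd ?_ (lt_irrefl (toLex (vanExp k r a ∘ w.symm + m)))
  nth_rewrite 2 [h5]
  rw [toLex_add, toLex_add]
  exact add_lt_add_of_le_of_lt h6 hlt

end top

theorem exists_perm_of_mem_stdExp {a : Fin r → ℕ} (ha : ∀ i, a i + 1 = k) {m : Fin (r + k) → ℕ}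
    (hm : m ∈ stdExp k (r + k) k) :
    ∃ w : Equiv.Perm (Fin (r + k)), StrictMono (fun j => w (Fin.natAdd r j)) ∧
      m ≤ vanExp k r a ∘ w.symm := by
  obtain ⟨h1, g, hg, hgs⟩ := exists_strictMono_of_mem_stdExp hm
  obtain ⟨w, hw⟩ := exists_perm_apply_natAdd g hg.injective
  refine ⟨w, fun i j hij => by simpa [hw] using hg hij, fun i => ?_⟩
  obtain ⟨i, rfl⟩ := w.surjective i
  rw [Function.comp_apply, Equiv.symm_apply_apply]
  induction i using Fin.addCases with
  | left i =>
    have := h1 (w (Fin.castAdd k i))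
    have := ha i
    simp only [vanExp, Fin.append_left]
    omega
  | right j =>
    have := hgs j
    rw [hw]
    simp only [vanExp, Fin.append_right]
    omega

theorem linearIndependent_act_xPow_vandermonde {a : Fin r → ℕ} (ha : ∀ i, a i + 1 = k) :
    LinearIndependent ℚ fun m : stdExp k (r + k) k =>
      act (r + k) (xPow m) (vandermonde k r a) := by
  rw [vandermonde_eq_alternant, linearIndependent_iff']
  intro s c hc
  by_contra! hcon
  obtain ⟨i, his, hi⟩ := hcon
  -- The functional attached to the lex-smallest exponent in the relation isolates its coefficient.
  obtain ⟨m, hm, hmin⟩ := (s.filter fun m => c m ≠ 0).exists_min_image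
    (fun m => toLex (m : Fin (r + k) → ℕ)) ⟨i, by simp [his, hi]⟩
  rw [Finset.mem_filter] at hm
  obtain ⟨w₀, hmono, hle⟩ := exists_perm_of_mem_stdExp ha m.2
  have h := congrArg (coeffMinor w₀ (vanExp k r a ∘ w₀.symm - m)) hc
  rw [map_sum, map_zero, Finset.sum_eq_single_of_mem m hm.1] at h
  · rw [map_smul, smul_eq_mul] at h
    exact mul_ne_zero hm.2 (coeffMinor_act_xPow_self_ne_zero hle) h
  · intro m' hm' hne
    rw [map_smul]
    by_cases h0 : c m' = 0
    · rw [h0, zero_smul]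
    · have h1 := hmin m' (by simp [hm', h0])
      have h2 : toLex (m : Fin (r + k) → ℕ) ≠ toLex (m' : Fin (r + k) → ℕ) :=
        fun h => hne (Subtype.ext (toLex.injective h)).symm
      rw [coeffMinor_act_xPow_eq_zero ha hmono hle (lt_of_le_of_ne h1 h2), smul_zero]

end

/-! ### Grading, dimensions and the basis of `V` -/

section

theorem isInternal_of_iSupIndep_of_iSup_eq_top {M : Type*} [AddCommMonoid M] [Module ℚ M]
    {A : ℕ → Submodule ℚ M} (h : iSupIndep A) (h' : iSup A = ⊤) : DirectSum.IsInternal A := by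
  let _ : AddCommGroup M := Module.addCommMonoidToAddCommGroup ℚ
  exact (DirectSum.isInternal_submodule_iff_iSupIndep_and_iSup_eq_top A).2 ⟨h, h'⟩

theorem finite_submodule {M : Type*} [AddCommMonoid M] [Module ℚ M] [Module.Finite ℚ M]
    (N : Submodule ℚ M) : Module.Finite ℚ N := by
  let _ : AddCommGroup M := Module.addCommMonoidToAddCommGroup ℚ
  exact FiniteDimensional.finiteDimensional_submodule N

section grading

variable {n : ℕ}

/-- The projection of superspace onto its part of `x`-degree `d`. -/
def xComponent (n d : ℕ) : Superspace n →ₗ[ℚ] Superspace n :=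
  TensorProduct.map (MvPolynomial.homogeneousComponent d) LinearMap.id

theorem xComponent_of_mem {d e : ℕ} {v : Superspace n} (hv : v ∈ xHomogeneous n e) :
    xComponent n d v = if d = e then v else 0 := by
  obtain ⟨t, rfl⟩ := hv
  induction t with
  | zero => simp
  | tmul f ω =>
    rw [TensorProduct.map_tmul, xComponent, TensorProduct.map_tmul, Submodule.subtype_apply,
      MvPolynomial.homogeneousComponent_of_mem f.2]
    split_ifs <;> simp
  | add s t hs ht =>
    rw [map_add, map_add, hs, ht]
    split_ifs <;> simp

theorem mono_mem_xHomogeneous (p : Fin n → ℕ) (ω : ExteriorAlgebra ℚ (Fin n → ℚ)) :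
    mono p ω ∈ xHomogeneous n (∑ i, p i) := by
  refine ⟨⟨MvPolynomial.monomial (Finsupp.equivFunOnFinite.symm p) 1,
    MvPolynomial.isHomogeneous_monomial _ ?_⟩ ⊗ₜ ω, rfl⟩
  rw [Finsupp.degree_eq_sum]
  rfl

/-- Projection to degree `d` is the identity on the piece of degree `d` and kills the others; `W`
itself need not be graded. -/
theorem iSupIndep_gradedPiece (W : Submodule ℚ (Superspace n)) : iSupIndep (gradedPiece W) := by
  intro d
  rw [Submodule.disjoint_def]
  intro v hv hv'
  have hker : (⨆ e, ⨆ (_ : e ≠ d), gradedPiece W e) ≤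
      LinearMap.ker ((xComponent n d).comp W.subtype) := by
    refine iSup₂_le fun e he u hu => ?_
    rw [LinearMap.mem_ker, LinearMap.comp_apply]
    exact (xComponent_of_mem hu).trans (if_neg he.symm)
  have h1 := hker hv'
  rw [LinearMap.mem_ker, LinearMap.comp_apply] at h1
  have h2 : xComponent n d (W.subtype v) = W.subtype v :=
    (xComponent_of_mem hv).trans (if_pos rfl)
  rw [h1] at h2
  exact Subtype.ext h2.symm

variable {ι : Type*} {b : ι → Superspace n} {deg : ι → ℕ}

theorem isInternal_gradedPiece_span (hb : ∀ i, b i ∈ xHomogeneous n (deg i)) :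
    DirectSum.IsInternal (gradedPiece (Submodule.span ℚ (Set.range b))) := by
  generalize hW : Submodule.span ℚ (Set.range b) = W
  refine isInternal_of_iSupIndep_of_iSup_eq_top (iSupIndep_gradedPiece W) ?_
  have hle : W ≤ (⨆ d, gradedPiece W d).map W.subtype := by
    rw [← hW, Submodule.span_le, hW]
    rintro _ ⟨i, rfl⟩
    exact ⟨⟨b i, hW ▸ Submodule.subset_span ⟨i, rfl⟩⟩,
      Submodule.mem_iSup_of_mem (deg i) (hb i), rfl⟩
  rw [eq_top_iff]
  intro v _
  obtain ⟨u, hu, huv⟩ := hle v.2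
  rwa [← Subtype.ext huv]

theorem finrank_gradedPiece_span [Fintype ι] (hb : ∀ i, b i ∈ xHomogeneous n (deg i))
    (hli : LinearIndependent ℚ b) (d : ℕ) :
    Module.finrank ℚ (gradedPiece (Submodule.span ℚ (Set.range b)) d) =
      Fintype.card {i // deg i = d} := by
  set W := Submodule.span ℚ (Set.range b) with hW
  have hspan : (gradedPiece W d).map W.subtype =
      Submodule.span ℚ (Set.range fun i : {i // deg i = d} => b i) := by
    rw [gradedPiece, Submodule.submoduleOf, Submodule.map_comap_subtype]
    refine le_antisymm ?_ (Submodule.span_le.2 ?_)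
    · rintro v ⟨hv, hvd⟩
      have hle : W ≤ (Submodule.span ℚ (Set.range fun i : {i // deg i = d} => b i)).comap
          (xComponent n d) := by
        refine Submodule.span_le.2 ?_
        rintro _ ⟨i, rfl⟩
        rw [SetLike.mem_coe, Submodule.mem_comap, xComponent_of_mem (hb i)]
        split_ifs with h
        · exact Submodule.subset_span ⟨⟨i, h.symm⟩, rfl⟩
        · exact Submodule.zero_mem _
      have := hle hv
      rwa [Submodule.mem_comap, xComponent_of_mem hvd, if_pos rfl] at this
    · rintro _ ⟨⟨i, rfl⟩, rfl⟩
      exact ⟨Submodule.subset_span ⟨i, rfl⟩, hb i⟩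
  rw [← Submodule.finrank_map_subtype_eq, hspan]
  exact finrank_span_eq_card (hli.comp _ Subtype.val_injective)

end grading

variable {k r : ℕ} {a : Fin r → ℕ}

theorem act_mem {n : ℕ} {W : Submodule ℚ (Superspace n)}
    (hW : ∀ i, ∀ f ∈ W, partialX i f ∈ W) (g : MvPolynomial (Fin n) ℚ) :
    ∀ v ∈ W, act n g v ∈ W := by
  induction g using MvPolynomial.induction_on with
  | C c =>
    intro v hv
    rw [← MvPolynomial.algebraMap_eq, AlgHom.commutes, Module.algebraMap_end_apply]
    exact W.smul_mem _ hv
  | add p q hp hq =>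
    intro v hv
    rw [map_add, LinearMap.add_apply]
    exact W.add_mem (hp v hv) (hq v hv)
  | mul_X p i hp =>
    intro v hv
    rw [act_mul_apply, act_X]
    exact hp _ (hW i v hv)

theorem act_vandermonde_mem_span (ha : ∀ i, a i + 1 = k) (g : MvPolynomial (Fin (r + k)) ℚ) :
    act (r + k) g (vandermonde k r a) ∈ Submodule.span ℚ (Set.range
      fun m : stdExp k (r + k) k => act (r + k) (xPow m) (vandermonde k r a)) := by
  let ψ : MvPolynomial (Fin (r + k)) ℚ →ₗ[ℚ] Superspace (r + k) :=
    (LinearMap.applyₗ (vandermonde k r a)).comp (act (r + k)).toLinearMap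
  have hψ : ∀ f, ψ f = act (r + k) f (vandermonde k r a) := fun f => rfl
  -- Straightening with `N` the annihilator of `Δ` and `u = 1`; for counter `k` and `r + k`
  -- variables the required relations are exactly `e_d` with `d > r`.
  have h := aeval_mul_mem_sup_span k (MvPolynomial.X : Fin (r + k) → MvPolynomial _ ℚ) k
    (LinearMap.ker ψ) 1
    (fun i v hv => by
      rw [LinearMap.mem_ker, hψ] at hv ⊢
      rw [act_mul_apply, hv, map_zero])
    (fun i => by
      rw [mul_one, LinearMap.mem_ker, hψ]
      exact act_X_pow_vandermonde (fun i => by have := ha i; omega) i)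
    (fun d hd => by
      rw [mul_one, LinearMap.mem_ker, hψ]
      exact act_elemSym_vandermonde a (by omega)) g
  rw [MvPolynomial.aeval_X_left, AlgHom.id_apply, mul_one] at h
  obtain ⟨f, hf, g', hg', rfl⟩ := Submodule.mem_sup.1 h
  rw [← hψ, map_add, LinearMap.mem_ker.1 hf, zero_add]
  have hle : Submodule.span ℚ ((fun m : Fin (r + k) → ℕ =>
      (∏ i, (MvPolynomial.X i : MvPolynomial _ ℚ) ^ m i) * 1) '' stdExp k (r + k) k) ≤
      (Submodule.span ℚ (Set.range fun m : stdExp k (r + k) k =>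
        act (r + k) (xPow m) (vandermonde k r a))).comap ψ := by
    refine Submodule.span_le.2 ?_
    rintro _ ⟨m, hm, rfl⟩
    refine Submodule.subset_span ⟨⟨m, hm⟩, ?_⟩
    beta_reduce
    rw [hψ, mul_one, xPow]
  exact hle hg'

theorem V_eq_span (ha : ∀ i, a i + 1 = k) :
    V k r a = Submodule.span ℚ (Set.range
      fun m : stdExp k (r + k) k => act (r + k) (xPow m) (vandermonde k r a)) := by
  refine le_antisymm (sInf_le ⟨?_, ?_⟩) (Submodule.span_le.2 ?_)
  · have := act_vandermonde_mem_span ha 1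
    rwa [map_one, Module.End.one_apply] at this
  · intro i f hf
    have hle : Submodule.span ℚ (Set.range
        fun m : stdExp k (r + k) k => act (r + k) (xPow m) (vandermonde k r a)) ≤
        (Submodule.span ℚ (Set.range fun m : stdExp k (r + k) k =>
          act (r + k) (xPow m) (vandermonde k r a))).comap (partialX i) := by
      refine Submodule.span_le.2 ?_
      rintro _ ⟨m, rfl⟩
      have := act_vandermonde_mem_span ha (MvPolynomial.X i * xPow m)
      rwa [act_mul_apply, act_X] at this
    exact hle hf
  · rintro _ ⟨m, rfl⟩
    refine Submodule.mem_sInf.2 fun W hW => act_mem hW.2 _ _ hW.1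

theorem sum_vanExp (ha : ∀ i, a i + 1 = k) :
    ∑ i, vanExp k r a i = r * (k - 1) + ∑ j ∈ Finset.range k, j := by
  rw [Fin.sum_univ_add, ← Finset.sum_range_reflect]
  simp only [vanExp, Fin.append_left, Fin.append_right]
  rw [Finset.sum_range, Finset.sum_congr rfl fun i _ => show a i = k - 1 by
    have := ha i; omega]
  simp

theorem act_xPow_vandermonde_mem (ha : ∀ i, a i + 1 = k) {m : Fin (r + k) → ℕ}
    (hm : m ∈ stdExp k (r + k) k) :
    act (r + k) (xPow m) (vandermonde k r a) ∈
      xHomogeneous (r + k) (stdCodeg k (r + k) k m) := by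
  rw [vandermonde_eq_alternant, act_xPow_alternant]
  refine Submodule.sum_mem _ fun w _ => Submodule.smul_mem _ _ ?_
  by_cases h : ∏ i, (vanExp k r a (w.symm i)).descFactorial (m i) = 0
  · rw [h, Nat.cast_zero, zero_smul]
    exact Submodule.zero_mem _
  have hle : m ≤ vanExp k r a ∘ w.symm := prod_descFactorial_ne_zero_iff.1 h
  have h1 := (sum_add_stdCodeg _ hm).2
  have h2 : ∑ i, (vanExp k r a ∘ w.symm - m) i + ∑ i, m i =
      r * (k - 1) + ∑ j ∈ Finset.range k, j := by
    rw [← Finset.sum_add_distrib, ← sum_vanExp ha, ← Equiv.sum_comp w.symm (vanExp k r a)]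
    exact Finset.sum_congr rfl fun i _ => Nat.sub_add_cancel (hle i)
  rw [Nat.add_sub_cancel] at h1
  have h3 : ∑ i, (vanExp k r a ∘ w.symm - m) i = stdCodeg k (r + k) k m := by omega
  rw [← h3]
  exact Submodule.smul_mem _ _ (mono_mem_xHomogeneous _ _)

end

end SuperVandermonde

end

theorem corollary3p6 (k r : ℕ) (a : Fin r → ℕ) (ha : ∀ i, (a i : ℤ) = (k : ℤ) - 1) :
    DirectSum.IsInternal (SuperVandermonde.gradedPiece (SuperVandermonde.V k r a)) ∧
    (∀ d, Module.Finite ℚ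
      (SuperVandermonde.gradedPiece (SuperVandermonde.V k r a) d)) ∧
    SuperVandermonde.hilb (SuperVandermonde.V k r a) =
      ((SuperVandermonde.qFactorial k * SuperVandermonde.qStirling (r + k) k :
        Polynomial ℤ) : PowerSeries ℤ) := by
  open SuperVandermonde in
  -- The integer equation forces `k ≥ 1` as soon as `r > 0`; this form avoids truncated subtraction.
  have ha : ∀ i, a i + 1 = k := fun i => by have := ha i; omega
  have hb := fun m : stdExp k (r + k) k => act_xPow_vandermonde_mem ha m.2
  rw [V_eq_span ha]
  refine ⟨isInternal_gradedPiece_span hb, fun d => ?_, ?_⟩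
  · have := Module.Finite.span_of_finite ℚ (Set.finite_range
      fun m : stdExp k (r + k) k => act (r + k) (xPow m) (vandermonde k r a))
    exact finite_submodule _
  · ext d
    rw [hilb, PowerSeries.coeff_mk,
      finrank_gradedPiece_span hb (linearIndependent_act_xPow_vandermonde ha), ← stdGen_self,
      ← sum_X_pow_stdCodeg _ le_rfl, Polynomial.coeff_coe, Polynomial.finsetSum_coeff]
    simp only [Polynomial.coeff_X_pow]
    rw [Fintype.card_subtype, Finset.card_filter, Nat.cast_sum,
      ← Finset.sum_coe_sort (stdExp k (r + k) k)]
    exact Finset.sum_congr rfl fun m _ => by simp [eq_comm]
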